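/- Let $G=(V,E)$ be a finite simple graph. For $d\ge 0$, a *spherical framework* $(G,p)$ in the unit sphere $\mathbb S^{d-1}\subset\mathbb R^d$ is a map $p:V\to\mathbb S^{d-1}$ whose image spans $\mathbb R^d$. $(G,p)$ is *universally rigid* if the Gram matrix $(p(i)\cdot p(j))_{i,j\in V}$ is the only positive semidefinite matrix $X\in\mathbb R^{V\times V}$ with $X_{ii}=1$ for all $i\in V$ and $X_{ij}=p(i)\cdot p(j)$ for all $ij\in E$. $(G,p)$ is *super stable* if (a) there is $\omega\in\mathbb R^{V\cup E}$ such that $\omega(i)p(i)+\sum_{j:\,ij\in E}\omega(ij)p(j)=0$ for every $i\in V$, and such that the symmetric matrix $\Omega\in\mathbb R^{V\times V}$ with $\Omega_{ii}=\omega(i)$, $\Omega_{ij}=\omega(ij)$ for $ij\in E$, and all other entries $0$, is positive semidefinite with $\dim\ker\Omega=d$; and (b) there is no nonzero symmetric $S\in\mathbb R^{d\times d}$ with $p(i)^\top S\,p(i)=0$ for all $i\in V$ and $p(i)^\top S\,p(j)=0$ for all $ij\in E$. A graph is *chordal* if it has no induced cycle of length at least four. **Theorem.** If $G$ is chordal,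 then for every $d$ every universally rigid spherical framework $(G,p)$ in $\mathbb S^{d-1}$ is super stable. Conversely, if $G$ is connected and, for every $d$, every universally rigid spherical framework $(G,p)$ in $\mathbb S^{d-1}$ is super stable, then $G$ is chordal. In particular, for a connected graph $G$, every universally rigid spherical framework $(G,p)$ is super stable if and only if $G$ is chordal. -/

import Mathlib

/-- A graph is chordal if it has no hole, i.e. no induced cycle of length at least four. -/
def IsChordalGraph {V : Type*} (G : SimpleGraph V) : Prop :=
  ∀ n : ℕ, 4 ≤ n → IsEmpty (SimpleGraph.cycleGraph n ↪g G)

/-- A placement of the vertex set `V` on the unit sphere of `ℝ^d` whose points span `ℝ^d`.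
Together with a graph on `V` this is a spherical framework in the unit sphere of `ℝ^d`;
the spanning condition says that its Gram matrix has rank `d`. -/
structure SphericalPlacement (V : Type*) (d : ℕ) where
  /-- the position of each vertex -/
  pos : V → EuclideanSpace ℝ (Fin d)
  norm_pos : ∀ i, ‖pos i‖ = 1
  span_pos : Submodule.span ℝ (Set.range pos) = ⊤

/-- `X` is a solution of the positive semidefinite completion problem on `G` whose prescribed
data are ones on the diagonal and the entries of `A` at the edges of `G`. -/
def IsPSDCompletion {V : Type*} (G : SimpleGraph V) (A X : Matrix V V ℝ) : Prop :=
  X.PosSemidef ∧ (∀ i, X i i = 1) ∧ ∀ i j, G.Adj i j → X i j = A i j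

/-- `(G, p)` is universally rigid if the Gram matrix of `p` is the unique solution of the
completion problem given by the inner products `⟪p i, p j⟫` along the edges of `G`. -/
def IsUniversallyRigid {V : Type*} (G : SimpleGraph V) {d : ℕ}
    (p : SphericalPlacement V d) : Prop :=
  ∀ X : Matrix V V ℝ, IsPSDCompletion G (Matrix.gram ℝ p.pos) X ↔ X = Matrix.gram ℝ p.pos

/-- A stress of `G`: a real weight on every vertex and on every edge. -/
structure SphericalStress {V : Type*} (G : SimpleGraph V) where
  /-- the weights of the vertices -/
  vertex : V → ℝ
  /-- the weights of the edges -/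
  edge : G.edgeSet → ℝ

namespace SphericalStress

variable {V : Type*} {G : SimpleGraph V}

open Classical in
/-- The weight of the edge `ij`, and `0` if `i` and `j` are not adjacent. -/
noncomputable def weight (ω : SphericalStress G) (i j : V) : ℝ :=
  if h : G.Adj i j then ω.edge ⟨s(i, j), h⟩ else 0

open Classical in
/-- The stress matrix `Ω`: vertex weights on the diagonal, edge weights at the edges of `G`,
zeros elsewhere. -/
noncomputable def toMatrix (ω : SphericalStress G) : Matrix V V ℝ :=
  Matrix.of fun i j => if i = j then ω.vertex i else ω.weight i j

/-- The equilibrium condition `ω(i) p(i) + ∑_{ij ∈ E} ω(ij) p(j) = 0` at every vertex `i`. -/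
def IsEquilibrium [Fintype V] (ω : SphericalStress G) {d : ℕ}
    (p : SphericalPlacement V d) : Prop :=
  ∀ i, ω.vertex i • p.pos i + ∑ j, ω.weight i j • p.pos j = 0

end SphericalStress

/-- No nonzero symmetric `d × d` matrix `S` satisfies `p(i)ᵀ S p(i) = 0` for all vertices `i` and
`p(i)ᵀ S p(j) = 0` for all edges `ij`. -/
def IsConicFree {V : Type*} (G : SimpleGraph V) {d : ℕ} (p : SphericalPlacement V d) : Prop :=
  ∀ S : Matrix (Fin d) (Fin d) ℝ, S.IsSymm →
    (∀ i, (p.pos i).ofLp ⬝ᵥ S.mulVec (p.pos i).ofLp = 0) →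
    (∀ i j, G.Adj i j → (p.pos i).ofLp ⬝ᵥ S.mulVec (p.pos j).ofLp = 0) → S = 0

/-- `(G, p)` is super stable if it has an equilibrium stress with positive semidefinite stress
matrix of corank `d` and the points of `p` satisfy the conic condition. -/
def IsSuperStable {V : Type*} [Fintype V] (G : SimpleGraph V) {d : ℕ}
    (p : SphericalPlacement V d) : Prop :=
  (∃ ω : SphericalStress G, ω.IsEquilibrium p ∧ ω.toMatrix.PosSemidef ∧
    Module.finrank ℝ (LinearMap.ker ω.toMatrix.mulVecLin) = d) ∧ IsConicFree G p

/-!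
Let `p` be universally rigid on a chordal graph `G`. Consider the vectors `v` on `V` that agree on
every clique with a vector in the column space of the matrix `P` of `p`. They form the kernel of a
sum of clique-supported positive semidefinite matrices, hence of a positive semidefinite matrix
supported on `G`. For small `ε > 0` the partial matrix given by `P Pᵀ - ε v vᵀ` on `G` is positive
semidefinite on every clique, so it has a completion `X` because `G` is chordal. Rigidity gives
`X + ε v vᵀ = P Pᵀ`, so that `v` lies in the column space of `P`: the kernel is exactly the column
space and the matrix is a stress matrix of corank `d`.

Conversely, the property that universal rigidity implies super stability passes to edge
contractions: pull a framework back along the contraction. A connected nonchordal graph all of whose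
edge contractions are chordal contains an induced square `x u y v`, and the other vertices are
either all adjacent exactly to `x` and `y` in the square, or all adjacent to the whole square. Put
`x` and `u` at one vertex of a simplex, put `y`, and in the second case also `v`, at further
vertices, and put everything else at the barycenter. This framework is universally rigid, but a
positive semidefinite stress matrix annihilating it also annihilates the indicator of `{x, u}`, so
its kernel is too large.
-/

section Graph

open SimpleGraph

variable {V : Type*} {G : SimpleGraph V}

theorem exists_boundary_adj_of_reachable {a b : V} {S : Set V} (h : G.Reachable a b) (ha : a ∈ S)
    (hb : b ∉ S) : ∃ i ∈ S, ∃ j ∉ S, G.Adj i j := by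
  obtain ⟨w⟩ := h
  obtain ⟨e, -, hi, hj⟩ := w.exists_boundary_dart S ha hb
  exact ⟨e.fst, hi, e.snd, hj, e.adj⟩

/-- The graph on all of `V` whose edges are the edges of `G` inside `T`. Unlike `G.induce T`, it
keeps the vertex type, so that different sets `T` can be compared. -/
def within (G : SimpleGraph V) (T : Set V) : SimpleGraph V :=
  ((⊤ : G.Subgraph).induce T).spanningCoe

theorem within_mono {S T : Set V} (h : S ⊆ T) : within G S ≤ within G T :=
  fun _ _ hij => ⟨h hij.1, h hij.2.1, hij.2.2⟩

/-- The connected component of `a` in the part of `G` inside `R`, as a set of vertices of `G`;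
meaningful for `a ∈ R`. -/
def component (G : SimpleGraph V) (R : Set V) (a : V) : Set V :=
  {v | (within G R).Reachable a v}

theorem mem_component_self (R : Set V) (a : V) : a ∈ component G R a :=
  Reachable.refl a

theorem component_subset {R : Set V} {a : V} (ha : a ∈ R) : component G R a ⊆ R := by
  intro v hv
  by_contra hvR
  obtain ⟨_, -, _, hj, hij⟩ := exists_boundary_adj_of_reachable hv ha hvR
  exact hj hij.2.1

theorem mem_component_of_adj {R : Set V} {a i j : V} (ha : a ∈ R) (hi : i ∈ component G R a)
    (hj : j ∈ R) (hij : G.Adj i j) : j ∈ component G R a :=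
  Reachable.trans hi (Adj.reachable ⟨component_subset ha hi, hj, hij⟩)

theorem reachable_within_component {R : Set V} {a v : V} (hv : v ∈ component G R a) :
    (within G (component G R a)).Reachable a v := by
  by_contra h
  obtain ⟨i, hi, j, hj, hij⟩ := exists_boundary_adj_of_reachable hv
    (S := {u | u ∈ component G R a ∧ (within G (component G R a)).Reachable a u})
    ⟨mem_component_self R a, Reachable.refl a⟩ fun hv' => h hv'.2
  have hjR : j ∈ component G R a := Reachable.trans hi.1 hij.reachable
  exact hj ⟨hjR, hi.2.trans (Adj.reachable ⟨hi.1, hjR, hij.2.2⟩)⟩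

theorem exists_mem_component_adj {R : Set V} {a b x : V} (ha : a ∈ R)
    (hb : b ∉ component G R a) (hx : (within G (insert x R)).Reachable a b) :
    ∃ v ∈ component G R a, G.Adj x v := by
  obtain ⟨i, hi, j, hj, -, hjR, hij⟩ :=
    exists_boundary_adj_of_reachable hx (mem_component_self R a) hb
  obtain rfl | hjR := hjR
  · exact ⟨i, hi, hij.symm⟩
  · exact absurd (mem_component_of_adj ha hi hjR hij) hj

/-- The vertices `f 0, …, f m` are distinct and form an induced path of `G` in this order. The
values of `f` beyond `m` are irrelevant. -/
def IsInducedPath (G : SimpleGraph V) (m : ℕ) (f : ℕ → V) : Prop :=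
  ∀ ⦃i j⦄, i < j → j ≤ m → f i ≠ f j ∧ (G.Adj (f i) (f j) ↔ j = i + 1)

theorem exists_isInducedPath_of_reachable {x y : V} (h : G.Reachable x y) :
    ∃ m f, f 0 = x ∧ f m = y ∧ IsInducedPath G m f := by
  obtain ⟨w, hw⟩ := h.exists_walk_length_eq_dist
  have hdist : ∀ i ≤ w.length, G.dist x (w.getVert i) = i := fun i hi => by
    rw [← length_eq_dist_of_subwalk hw (w.isSubwalk_take i), Walk.take_length, min_eq_left hi]
  refine ⟨w.length, w.getVert, w.getVert_zero, w.getVert_length, fun i j hij hj => ?_⟩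
  have hi' := hdist i (hij.le.trans hj)
  have hj' := hdist j hj
  refine ⟨fun h => hij.ne (by rw [← hi', ← hj', h]), fun h => ?_, ?_⟩
  · have := h.diff_dist_adj (u := x)
    omega
  · rintro rfl
    exact w.adj_getVert_succ hj

theorem exists_isInducedPath_through {C : Set V} {a x y : V}
    (hC : ∀ v ∈ C, (within G C).Reachable a v) (hx : ∃ v ∈ C, G.Adj x v)
    (hy : ∃ v ∈ C, G.Adj y v) (hxy : ¬ G.Adj x y) (hne : x ≠ y) :
    ∃ m f, 2 ≤ m ∧ f 0 = x ∧ f m = y ∧ IsInducedPath G m f ∧ ∀ i, 0 < i → i < m → f i ∈ C := by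
  obtain ⟨u, hu, hxu⟩ := hx
  obtain ⟨v, hv, hyv⟩ := hy
  set D : Set V := insert x (insert y C)
  have hCD : C ⊆ D := (Set.subset_insert y C).trans (Set.subset_insert x _)
  have hxD : x ∈ D := Set.mem_insert x _
  have hyD : y ∈ D := Set.mem_insert_of_mem x (Set.mem_insert y C)
  have huv : (within G D).Reachable u v :=
    ((hC u hu).symm.trans (hC v hv)).mono (within_mono hCD)
  have hxu' : (within G D).Adj x u := ⟨hxD, hCD hu, hxu⟩
  have hvy' : (within G D).Adj v y := ⟨hCD hv, hyD, hyv.symm⟩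
  have hreach : (within G D).Reachable x y := hxu'.reachable.trans (huv.trans hvy'.reachable)
  obtain ⟨m, f, rfl, rfl, hf⟩ := exists_isInducedPath_of_reachable hreach
  have hmem : ∀ i ≤ m, f i ∈ D := fun i hi => by
    obtain rfl | hlt := hi.eq_or_lt
    · exact hyD
    · exact ((hf i.lt_succ_self hlt).2.2 rfl).1
  refine ⟨m, f, ?_, rfl, rfl, fun i j hij hj => ⟨(hf hij hj).1, fun h => ?_, fun h => ?_⟩, ?_⟩
  · by_contra! hm
    interval_cases m
    · exact hne rfl
    · exact hxy ((hf zero_lt_one le_rfl).2.2 rfl).2.2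
  · exact (hf hij hj).2.1 ⟨hmem i (hij.le.trans hj), hmem j hj, h⟩
  · exact ((hf hij hj).2.2 h).2.2
  · intro i hi him
    obtain h | h | h := hmem i him.le
    · exact absurd h.symm (hf hi him.le).1
    · exact absurd h (hf him le_rfl).1
    · exact h

theorem cycleGraph_adj_of_lt {n : ℕ} {i j : Fin n} (hij : i < j) :
    (cycleGraph n).Adj i j ↔ (j.val = i.val + 1 ∨ (i.val = 0 ∧ j.val = n - 1)) := by
  have : i.val < j.val := hij
  rw [cycleGraph_adj', Fin.sub_val_of_le hij.le, Fin.val_sub, Nat.mod_eq_of_lt (by omega)]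
  omega

theorem nonempty_cycleGraph_embedding {n : ℕ} (c : Fin n → V)
    (hc : ∀ i j : Fin n, i < j → c i ≠ c j ∧
      (G.Adj (c i) (c j) ↔ (j.val = i.val + 1 ∨ (i.val = 0 ∧ j.val = n - 1)))) :
    Nonempty (cycleGraph n ↪g G) := by
  have hinj : Function.Injective c := fun i j h => by
    obtain hij | hij | hij := lt_trichotomy i j
    · exact absurd h (hc i j hij).1
    · exact hij
    · exact absurd h.symm (hc j i hij).1
  refine ⟨⟨⟨c, hinj⟩, fun {i j} => ?_⟩⟩
  change G.Adj (c i) (c j) ↔ _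
  obtain hij | rfl | hij := lt_trichotomy i j
  · rw [cycleGraph_adj_of_lt hij, (hc i j hij).2]
  · simp only [SimpleGraph.irrefl]
  · rw [G.adj_comm, (cycleGraph n).adj_comm, cycleGraph_adj_of_lt hij, (hc j i hij).2]

theorem nonempty_cycleGraph_embedding_of_paths {m k : ℕ} {f g : ℕ → V} (hm : 2 ≤ m) (hk : 2 ≤ k)
    (hf : IsInducedPath G m f) (hg : IsInducedPath G k g) (h0 : f 0 = g 0) (h1 : f m = g k)
    (hfg : ∀ i j, 0 < i → i < m → 0 < j → j < k → f i ≠ g j ∧ ¬ G.Adj (f i) (g j)) :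
    Nonempty (cycleGraph (m + k) ↪g G) := by
  let c : ℕ → V := fun i => if i ≤ m then f i else g (m + k - i)
  have cf : ∀ i ≤ m, c i = f i := fun i hi => if_pos hi
  have cg : ∀ i, m ≤ i → c i = g (m + k - i) := fun i hi => by
    obtain rfl | hlt := hi.eq_or_lt
    · rw [cf _ le_rfl, h1, Nat.add_sub_cancel_left]
    · exact if_neg hlt.not_ge
  have hg' : ∀ i j, i < j → j ≤ k → g j ≠ g i ∧ (G.Adj (g j) (g i) ↔ j = i + 1) :=
    fun i j hij hj => ⟨(hg hij hj).1.symm, (G.adj_comm _ _).trans (hg hij hj).2⟩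
  refine nonempty_cycleGraph_embedding (fun i => c i) ?_
  rintro ⟨i, -⟩ ⟨j, hj⟩ (hij : i < j)
  change c i ≠ c j ∧ (G.Adj (c i) (c j) ↔ (j = i + 1 ∨ (i = 0 ∧ j = m + k - 1)))
  by_cases hjm : j ≤ m
  · rw [cf i (by omega), cf j hjm]
    exact ⟨(hf hij hjm).1, (hf hij hjm).2.trans (by omega)⟩
  rw [cg j (by omega)]
  by_cases him : m ≤ i
  · rw [cg i him]
    obtain ⟨hne, hadj⟩ := hg' (m + k - j) (m + k - i) (by omega) (by omega)
    exact ⟨hne, hadj.trans (by omega)⟩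
  rw [cf i (by omega)]
  obtain rfl | hi := i.eq_zero_or_pos
  · rw [h0]
    obtain ⟨hne, hadj⟩ := @hg 0 (m + k - j) (by omega) (by omega)
    exact ⟨hne, hadj.trans (by omega)⟩
  · obtain ⟨hne, hadj⟩ := hfg i (m + k - j) hi (by omega) (by omega) (by omega)
    exact ⟨hne, iff_of_false hadj (by omega)⟩

theorem IsChordalGraph.adj_of_adj_components (hG : IsChordalGraph G) {R : Set V} {a b x y : V}
    (ha : a ∈ R) (hb : b ∈ R) (hab : b ∉ component G R a)
    (hxa : ∃ v ∈ component G R a, G.Adj x v) (hya : ∃ v ∈ component G R a, G.Adj y v)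
    (hxb : ∃ v ∈ component G R b, G.Adj x v) (hyb : ∃ v ∈ component G R b, G.Adj y v)
    (hxy : x ≠ y) : G.Adj x y := by
  by_contra hadj
  have hdisj : ∀ v ∈ component G R a, v ∉ component G R b := fun v hva hvb =>
    hab (Reachable.trans hva (Reachable.symm hvb))
  obtain ⟨m, f, hm, f0, fm, hf, hfC⟩ := exists_isInducedPath_through
    (fun _ => reachable_within_component) hxa hya hadj hxy
  obtain ⟨k, g, hk, g0, gk, hg, hgC⟩ := exists_isInducedPath_through
    (fun _ => reachable_within_component) hxb hyb hadj hxy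
  obtain ⟨e⟩ := nonempty_cycleGraph_embedding_of_paths hm hk hf hg (f0.trans g0.symm)
    (fm.trans gk.symm) fun i j hi him hj hjk => by
      refine ⟨fun h => hdisj _ (hfC i hi him) (h ▸ hgC j hj hjk), fun h => ?_⟩
      have hgR : g j ∈ R := component_subset hb (hgC j hj hjk)
      exact hdisj _ (mem_component_of_adj ha (hfC i hi him) hgR h) (hgC j hj hjk)
  exact (hG (m + k) (by omega)).false e

theorem exists_minimal_separator [Finite V] {T : Set V} {a b : V} (ha : a ∈ T)
    (hne : a ≠ b) (hab : ¬ G.Adj a b) :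
    ∃ S ⊆ T, a ∉ S ∧ b ∉ S ∧ ¬ (within G (T \ S)).Reachable a b ∧
      ∀ x ∈ S, (within G (insert x (T \ S))).Reachable a b := by
  let Separators : Set (Set V) := {S | S ⊆ T ∧ a ∉ S ∧ b ∉ S ∧ ¬ (within G (T \ S)).Reachable a b}
  have hex : Separators.Nonempty := by
    refine ⟨T \ {a, b}, Set.sdiff_subset, by simp, by simp, fun h => ?_⟩
    obtain ⟨i, rfl, j, hj, -, hjT, hij⟩ :=
      exists_boundary_adj_of_reachable h (Set.mem_singleton a) (Ne.symm hne)
    have hjb : j = b := by simpa [hjT.1, show j ≠ i from hj] using hjT.2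
    exact hab (hjb ▸ hij)
  obtain ⟨S, ⟨hST, haS, hbS, hsep⟩, hmin⟩ := Separators.toFinite.exists_minimal hex
  refine ⟨S, hST, haS, hbS, hsep, fun x hx => ?_⟩
  by_contra hreach
  have hins : T \ (S \ {x}) = insert x (T \ S) := by
    rw [Set.sdiff_sdiff_right, Set.inter_eq_right.2 (Set.singleton_subset_iff.2 (hST hx)),
      Set.union_singleton]
  have hsep' : S \ {x} ∈ Separators :=
    ⟨Set.sdiff_subset.trans hST, fun h => haS h.1, fun h => hbS h.1, hins ▸ hreach⟩
  exact (hmin hsep' Set.sdiff_subset hx).2 rfl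

theorem IsChordalGraph.exists_clique_separation [Finite V] (hG : IsChordalGraph G) {T : Set V}
    {a b : V} (ha : a ∈ T) (hb : b ∈ T) (hne : a ≠ b) (hab : ¬ G.Adj a b) :
    ∃ A B : Set V, A ∪ B = T ∧ a ∉ B ∧ b ∉ A ∧ G.IsClique (A ∩ B) ∧
      ∀ i ∈ A, ∀ j ∈ B, i ∉ B → j ∉ A → ¬ G.Adj i j := by
  obtain ⟨S, hST, haS, hbS, hsep, hmin⟩ := exists_minimal_separator ha hne hab
  set C := component G (T \ S) a
  have haR : a ∈ T \ S := ⟨ha, haS⟩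
  have hbR : b ∈ T \ S := ⟨hb, hbS⟩
  have hCT : C ⊆ T \ S := component_subset haR
  have hunion : C ∪ S ∪ T \ C = T := by
    ext v
    grind
  refine ⟨C ∪ S, T \ C, hunion, fun h => h.2 (mem_component_self _ a), ?_, ?_, ?_⟩
  · rintro (h | h)
    exacts [hsep h, hbS h]
  · have hS : ∀ x ∈ (C ∪ S) ∩ (T \ C), x ∈ S := fun x hx => hx.1.resolve_left hx.2.2
    have hSa : ∀ x ∈ S, ∃ v ∈ C, G.Adj x v := fun x hx =>
      exists_mem_component_adj haR hsep (hmin x hx)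
    have hSb : ∀ x ∈ S, ∃ v ∈ component G (T \ S) b, G.Adj x v := fun x hx =>
      exists_mem_component_adj hbR (fun h => hsep (Reachable.symm h)) (hmin x hx).symm
    exact fun x hx y hy => hG.adj_of_adj_components haR hbR hsep (hSa x (hS x hx))
      (hSa y (hS y hy)) (hSb x (hS x hx)) (hSb y (hS y hy))
  · intro i hi j hj hiB hjA hij
    have hiC : i ∈ C := by
      by_contra h
      exact hiB ⟨hST (hi.resolve_left h), h⟩
    exact hj.2 (mem_component_of_adj haR hiC ⟨hj.1, fun h => hjA (Or.inr h)⟩ hij)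

end Graph

section LinearAlgebra

open Filter Topology
open scoped Matrix RealInnerProductSpace

theorem exists_linearIsometry_comp_eq {M E : Type*} [AddCommGroup M] [Module ℝ M]
    [NormedAddCommGroup E] [InnerProductSpace ℝ E] [FiniteDimensional ℝ E] {f g : M →ₗ[ℝ] E}
    (h : ∀ x, ‖f x‖ = ‖g x‖) : ∃ U : E →ₗᵢ[ℝ] E, ∀ x, U (f x) = g x := by
  have hker : LinearMap.ker f ≤ LinearMap.ker g := fun x hx => by
    rw [LinearMap.mem_ker] at hx ⊢
    rw [← norm_eq_zero, ← h, hx, norm_zero]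
  let L := (LinearMap.ker f).liftQ g hker ∘ₗ f.quotKerEquivRange.symm.toLinearMap
  have hL : ∀ x, L ⟨f x, x, rfl⟩ = g x := fun x =>
    congrArg ((LinearMap.ker f).liftQ g hker) (f.quotKerEquivRange_symm_apply_image x ⟨x, rfl⟩)
  let U : LinearMap.range f →ₗᵢ[ℝ] E := ⟨L, by rintro ⟨_, x, rfl⟩; rw [hL]; exact (h x).symm⟩
  exact ⟨U.extend, fun x => (U.extend_apply ⟨f x, x, rfl⟩).trans (hL x)⟩

theorem exists_linearIsometry_of_gram_eq {ι E : Type*} [Finite ι] [NormedAddCommGroup E]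
    [InnerProductSpace ℝ E] [FiniteDimensional ℝ E] {q r : ι → E}
    (h : Matrix.gram ℝ q = Matrix.gram ℝ r) : ∃ U : E →ₗᵢ[ℝ] E, ∀ i, U (q i) = r i := by
  classical
  cases nonempty_fintype ι
  have hnorm : ∀ c, ‖Fintype.linearCombination ℝ q c‖ = ‖Fintype.linearCombination ℝ r c‖ := by
    intro c
    rw [← sq_eq_sq₀ (norm_nonneg _) (norm_nonneg _), ← real_inner_self_eq_norm_sq,
      ← real_inner_self_eq_norm_sq]
    simp only [Fintype.linearCombination_apply, ← Matrix.star_dotProduct_gram_mulVec, h]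
  obtain ⟨U, hU⟩ := exists_linearIsometry_comp_eq hnorm
  exact ⟨U, fun i => by simpa [Fintype.linearCombination_apply_single] using hU (Pi.single i 1)⟩

theorem eq_sum_smul_of_orthonormal {ι E : Type*} [Fintype ι] [NormedAddCommGroup E]
    [InnerProductSpace ℝ E] {z : ι → E} (hz : Orthonormal ℝ z) {w : E} {q : EuclideanSpace ℝ ι}
    (hnorm : ‖w‖ = ‖q‖) (h : ∀ j, ⟪w, z j⟫ = q j) : w = ∑ j, q j • z j := by
  have hsum : ⟪∑ j, q j • z j, ∑ j, q j • z j⟫ = ⟪q, q⟫ := by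
    rw [hz.inner_sum, PiLp.inner_apply]
    rfl
  have hcross : ⟪w, ∑ j, q j • z j⟫ = ⟪q, q⟫ := by
    simp only [inner_sum, inner_smul_right, h, PiLp.inner_apply]
    rfl
  rw [← sub_eq_zero, ← inner_self_eq_zero (𝕜 := ℝ), real_inner_sub_sub_self, hsum, hcross,
    real_inner_self_eq_norm_sq, real_inner_self_eq_norm_sq, hnorm]
  ring

variable {V m : Type*}

theorem exists_gram_eq_of_posSemidef [Fintype V] {M : Matrix V V ℝ} (hM : M.PosSemidef) :
    ∃ x : V → EuclideanSpace ℝ V, Matrix.gram ℝ x = M := by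
  classical
  open scoped MatrixOrder in
  obtain ⟨B, rfl⟩ := CStarAlgebra.nonneg_iff_eq_star_mul_self.mp hM.nonneg
  refine ⟨fun i => WithLp.toLp 2 fun k => B k i, ?_⟩
  ext i j
  simp [Matrix.mul_apply, Matrix.star_apply, Matrix.gram_apply, PiLp.inner_apply, mul_comm]

open scoped MatrixOrder in
theorem exists_posSemidef_add_smul_one [Finite m] [DecidableEq m] {S : Matrix m m ℝ}
    (hS : S.IsSymm) : ∃ c : ℝ, (S + c • 1).PosSemidef := by
  cases nonempty_fintype m
  obtain ⟨r, hr⟩ := (Matrix.finite_real_spectrum (A := S)).bddBelow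
  have hrS : algebraMap ℝ (Matrix m m ℝ) r ≤ S :=
    algebraMap_le_of_le_spectrum (fun _ hx => hr hx) hS
  refine ⟨-r, ?_⟩
  rwa [Matrix.le_iff, Algebra.algebraMap_eq_smul_one, sub_eq_add_neg, ← neg_smul] at hrS

theorem eventually_posSemidef_one_add_smul [Finite m] [DecidableEq m] {S : Matrix m m ℝ}
    (hS : S.IsSymm) : ∀ᶠ ε : ℝ in 𝓝[>] 0, (1 + ε • S).PosSemidef := by
  obtain ⟨c, hc⟩ := exists_posSemidef_add_smul_one hS
  have hsmall : ∀ᶠ ε : ℝ in 𝓝 0, ε * c < 1 :=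
    (continuous_mul_const c).continuousAt.eventually_lt_const (by simp)
  filter_upwards [hsmall.filter_mono nhdsWithin_le_nhds, self_mem_nhdsWithin] with ε hεc hε
  have : 1 + ε • S = (1 - ε * c) • 1 + ε • (S + c • 1) := by
    module
  rw [this]
  exact (Matrix.PosSemidef.one.smul (sub_nonneg.2 hεc.le)).add (hc.smul (le_of_lt hε))

theorem exists_posSemidef_ker_eq [Fintype V] (U : Submodule ℝ (V → ℝ)) :
    ∃ M : Matrix V V ℝ, M.PosSemidef ∧ LinearMap.ker M.mulVecLin = U := by
  classical
  obtain ⟨W, hUW⟩ := U.exists_isCompl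
  let B : Matrix V V ℝ := LinearMap.toMatrix' (W.projection U hUW.symm)
  refine ⟨Bᴴ * B, Matrix.posSemidef_conjTranspose_mul_self B, ?_⟩
  rw [Matrix.ker_mulVecLin_conjTranspose_mul_self, ← Matrix.toLin'_apply', Matrix.toLin'_toMatrix',
    Submodule.ker_projection]

theorem sum_mulVec_eq_zero_iff [Fintype V] {ι : Type*} {s : Finset ι} {M : ι → Matrix V V ℝ}
    (hM : ∀ k ∈ s, (M k).PosSemidef) (x : V → ℝ) :
    (∑ k ∈ s, M k) *ᵥ x = 0 ↔ ∀ k ∈ s, M k *ᵥ x = 0 := by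
  rw [← (Matrix.posSemidef_sum s hM).dotProduct_mulVec_zero_iff, Matrix.sum_mulVec, dotProduct_sum,
    Finset.sum_eq_zero_iff_of_nonneg fun k hk => (hM k hk).dotProduct_mulVec_nonneg x]
  exact forall₂_congr fun k hk => (hM k hk).dotProduct_mulVec_zero_iff x

theorem mem_range_mulVecLin_of_posSemidef_sub [Finite V] [Fintype m] {P : Matrix V m ℝ}
    {v : V → ℝ} {ε : ℝ} (hε : 0 < ε) (h : (P * Pᵀ - ε • Matrix.vecMulVec v v).PosSemidef) :
    v ∈ LinearMap.range P.mulVecLin := by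
  classical
  cases nonempty_fintype V
  by_contra hv
  obtain ⟨f, hfv, hf⟩ := Submodule.exists_le_ker_of_notMem hv
  obtain ⟨c, rfl⟩ := (dotProductEquiv ℝ V).surjective f
  rw [dotProductEquiv_apply_apply] at hfv
  have hcP : Pᵀ *ᵥ c = 0 := funext fun k => by
    have hk := hf ⟨Pi.single k 1, rfl⟩
    rwa [LinearMap.mem_ker, dotProductEquiv_apply_apply, Matrix.mulVecLin_apply,
      Matrix.mulVec_single_one, dotProduct_comm] at hk
  have hquad := h.dotProduct_mulVec_nonneg c
  rw [star_trivial, Matrix.sub_mulVec, ← Matrix.mulVec_mulVec, hcP, Matrix.mulVec_zero, zero_sub,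
    dotProduct_neg, Matrix.smul_mulVec, dotProduct_smul, Matrix.vecMulVec_mulVec, dotProduct_smul,
    dotProduct_comm v c] at hquad
  have : 0 < ε * ((c ⬝ᵥ v) * (c ⬝ᵥ v)) := mul_pos hε (mul_self_pos.2 hfv)
  simp only [smul_eq_mul, op_smul_eq_smul] at hquad
  linarith

end LinearAlgebra

section Completion

open scoped Matrix RealInnerProductSpace

variable {V : Type*} {G : SimpleGraph V}

/-- `M` vanishes at the non-adjacent pairs of distinct vertices of `G`, as the matrix of a stress
of `G` does. -/
def IsSupportedOn (G : SimpleGraph V) (M : Matrix V V ℝ) : Prop :=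
  ∀ i j, i ≠ j → ¬ G.Adj i j → M i j = 0

theorem exists_vectors_of_clique_separation [Fintype V] {A B : Set V} (hcl : G.IsClique (A ∩ B))
    (hno : ∀ i ∈ A, ∀ j ∈ B, i ∉ B → j ∉ A → ¬ G.Adj i j) {M : Matrix V V ℝ}
    {q r : V → EuclideanSpace ℝ V}
    (hq : ∀ i ∈ A, ∀ j ∈ A, i = j ∨ G.Adj i j → ⟪q i, q j⟫ = M i j)
    (hr : ∀ i ∈ B, ∀ j ∈ B, i = j ∨ G.Adj i j → ⟪r i, r j⟫ = M i j) :
    ∃ w : V → EuclideanSpace ℝ V,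
      ∀ i ∈ A ∪ B, ∀ j ∈ A ∪ B, i = j ∨ G.Adj i j → ⟪w i, w j⟫ = M i j := by
  classical
  obtain ⟨U, hU⟩ := exists_linearIsometry_of_gram_eq
    (q := fun i : ↥(A ∩ B) => r i) (r := fun i : ↥(A ∩ B) => q i) <| by
      ext ⟨i, hi⟩ ⟨j, hj⟩
      have hij : i = j ∨ G.Adj i j := or_iff_not_imp_left.2 (hcl hi hj)
      exact (hr i hi.2 j hj.2 hij).trans (hq i hi.1 j hj.1 hij).symm
  let w : V → EuclideanSpace ℝ V := fun i => if i ∈ A then q i else U (r i)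
  have hwA : ∀ i ∈ A, w i = q i := fun i hi => if_pos hi
  have hwB : ∀ i ∈ B, w i = U (r i) := fun i hi => by
    by_cases hiA : i ∈ A
    · exact (hwA i hiA).trans (hU ⟨i, hiA, hi⟩).symm
    · exact if_neg hiA
  have hAA : ∀ i ∈ A, ∀ j ∈ A, i = j ∨ G.Adj i j → ⟪w i, w j⟫ = M i j := fun i hi j hj hij => by
    rw [hwA i hi, hwA j hj, hq i hi j hj hij]
  have hBB : ∀ i ∈ B, ∀ j ∈ B, i = j ∨ G.Adj i j → ⟪w i, w j⟫ = M i j := fun i hi j hj hij => by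
    rw [hwB i hi, hwB j hj, U.inner_map_map, hr i hi j hj hij]
  refine ⟨w, fun i hi j hj hij => ?_⟩
  have hside : (i ∈ A ∧ j ∈ A) ∨ (i ∈ B ∧ j ∈ B) := by
    obtain rfl | hij := hij
    · simpa using hi
    · have := hno i
      have := hno j
      have := hij.symm
      grind
  obtain ⟨hiA, hjA⟩ | ⟨hiB, hjB⟩ := hside
  exacts [hAA i hiA j hjA hij, hBB i hiB j hjB hij]

theorem IsChordalGraph.exists_posSemidef_completion [Finite V] (hG : IsChordalGraph G)
    (M : Matrix V V ℝ)
    (hM : ∀ K : Set V, G.IsClique K →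
      ∃ N : Matrix V V ℝ, N.PosSemidef ∧ ∀ i ∈ K, ∀ j ∈ K, N i j = M i j) :
    ∃ X : Matrix V V ℝ, X.PosSemidef ∧ ∀ i j, i = j ∨ G.Adj i j → X i j = M i j := by
  cases nonempty_fintype V
  suffices hT : ∀ T : Set V, ∃ w : V → EuclideanSpace ℝ V,
      ∀ i ∈ T, ∀ j ∈ T, i = j ∨ G.Adj i j → ⟪w i, w j⟫ = M i j by
    obtain ⟨w, hw⟩ := hT Set.univ
    exact ⟨_, Matrix.posSemidef_gram ℝ w, fun i j => hw i trivial j trivial⟩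
  intro T
  induction T using WellFoundedLT.induction with
  | ind T ih =>
    by_cases hT : G.IsClique T
    · obtain ⟨N, hN, hNM⟩ := hM T hT
      obtain ⟨w, rfl⟩ := exists_gram_eq_of_posSemidef hN
      exact ⟨w, fun i hi j hj _ => hNM i hi j hj⟩
    · obtain ⟨a, ha, b, hb, hne, hab⟩ : ∃ a ∈ T, ∃ b ∈ T, a ≠ b ∧ ¬ G.Adj a b := by
        simpa [SimpleGraph.IsClique, Set.Pairwise] using hT
      obtain ⟨A, B, rfl, haB, hbA, hcl, hno⟩ := hG.exists_clique_separation ha hb hne hab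
      obtain ⟨q, hq⟩ := ih A (Set.ssubset_iff_of_subset Set.subset_union_left |>.2 ⟨b, hb, hbA⟩)
      obtain ⟨r, hr⟩ := ih B (Set.ssubset_iff_of_subset Set.subset_union_right |>.2 ⟨a, ha, haB⟩)
      exact exists_vectors_of_clique_separation hcl hno hq hr

theorem exists_posSemidef_isSupportedOn_ker [Fintype V] (G : SimpleGraph V)
    (U : Submodule ℝ (V → ℝ)) :
    ∃ M : Matrix V V ℝ, M.PosSemidef ∧ IsSupportedOn G M ∧
      ∀ x, M *ᵥ x = 0 ↔ ∀ K : Set V, G.IsClique K → ∃ u ∈ U, ∀ i ∈ K, u i = x i := by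
  classical
  let restrict (K : Set V) : (V → ℝ) →ₗ[ℝ] (K → ℝ) := LinearMap.funLeft ℝ ℝ Subtype.val
  choose M hM hker using fun K : Set V =>
    exists_posSemidef_ker_eq ((U.map (restrict K)).comap (restrict K))
  have hmem : ∀ K x, M K *ᵥ x = 0 ↔ ∃ u ∈ U, ∀ i ∈ K, u i = x i := fun K x => by
    rw [← Matrix.mulVecLin_apply, ← LinearMap.mem_ker, hker]
    simp [restrict, funext_iff]
  have hoff : ∀ K i j, j ∉ K → M K i j = 0 := fun K i j hj => by
    have h : M K *ᵥ Pi.single j 1 = 0 :=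
      (hmem K _).2 ⟨0, U.zero_mem, fun k hk => by simp [ne_of_mem_of_not_mem hk hj]⟩
    simpa using congrFun h i
  refine ⟨∑ K with G.IsClique K, M K, Matrix.posSemidef_sum _ fun K _ => hM K, ?_, fun x => ?_⟩
  · intro i j hij hadj
    rw [Matrix.sum_apply]
    refine Finset.sum_eq_zero fun K hK => ?_
    have hclique : G.IsClique K := by simpa using hK
    by_cases hj : j ∈ K
    · have hi : i ∉ K := fun hi => hadj (hclique hi hj hij)
      rw [← (hM K).isHermitian.apply, hoff K j i hi, star_zero]
    · exact hoff K i j hj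
  · rw [sum_mulVec_eq_zero_iff fun K _ => hM K]
    simp [hmem]

end Completion

section Placement

open Filter Topology
open scoped Matrix RealInnerProductSpace

variable {V : Type*} {G : SimpleGraph V} {d : ℕ}

/-- The `V × d` matrix whose rows are the points of the placement `p`. -/
def SphericalPlacement.toMatrix (p : SphericalPlacement V d) : Matrix V (Fin d) ℝ :=
  Matrix.of fun i => (p.pos i).ofLp

theorem SphericalPlacement.gram_pos (p : SphericalPlacement V d) :
    Matrix.gram ℝ p.pos = p.toMatrix * p.toMatrixᵀ := by
  ext i j
  simp [toMatrix, Matrix.gram_apply, Matrix.mul_apply, PiLp.inner_apply, mul_comm]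

theorem SphericalPlacement.gram_pos_self (p : SphericalPlacement V d) (i : V) :
    Matrix.gram ℝ p.pos i i = 1 := by
  rw [Matrix.gram_apply, real_inner_self_eq_norm_sq, p.norm_pos, one_pow]

theorem SphericalPlacement.toMatrix_mul_mul_transpose_apply (p : SphericalPlacement V d)
    (S : Matrix (Fin d) (Fin d) ℝ) (i j : V) :
    (p.toMatrix * S * p.toMatrixᵀ) i j = (p.pos i).ofLp ⬝ᵥ S *ᵥ (p.pos j).ofLp := by
  rw [Matrix.mul_apply', Matrix.dotProduct_mulVec]
  rfl

theorem SphericalPlacement.mulVec_toMatrix_injective (p : SphericalPlacement V d) :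
    Function.Injective p.toMatrix.mulVec := by
  refine (injective_iff_map_eq_zero p.toMatrix.mulVecLin).2 fun y hy => ?_
  have hzero : innerₛₗ ℝ (WithLp.toLp 2 y) = 0 := LinearMap.ext_on_range p.span_pos fun i => by
    simpa [toMatrix, Matrix.mulVec, dotProduct, PiLp.inner_apply, mul_comm] using congrFun hy i
  have hy0 : WithLp.toLp 2 y = (0 : EuclideanSpace ℝ (Fin d)) :=
    (inner_self_eq_zero (𝕜 := ℝ)).1 (LinearMap.congr_fun hzero _)
  exact congrArg WithLp.ofLp hy0

theorem SphericalPlacement.finrank_range_toMatrix (p : SphericalPlacement V d) :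
    Module.finrank ℝ (LinearMap.range p.toMatrix.mulVecLin) = d := by
  rw [LinearMap.finrank_range_of_inj p.mulVec_toMatrix_injective, Module.finrank_fin_fun]

theorem SphericalPlacement.eq_zero_of_toMatrix_mul {ι : Type*} (p : SphericalPlacement V d)
    {A : Matrix (Fin d) ι ℝ} (h : p.toMatrix * A = 0) : A = 0 := by
  ext i k
  have hcol : p.toMatrix *ᵥ A.col k = p.toMatrix *ᵥ 0 := by
    rw [Matrix.mulVec_zero]
    exact congrArg (Matrix.col · k) h
  exact congrFun (p.mulVec_toMatrix_injective hcol) i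

theorem SphericalPlacement.eq_zero_of_toMatrix_mul_mul_transpose (p : SphericalPlacement V d)
    {S : Matrix (Fin d) (Fin d) ℝ} (h : p.toMatrix * S * p.toMatrixᵀ = 0) : S = 0 := by
  rw [Matrix.mul_assoc] at h
  have hT := congrArg Matrix.transpose (p.eq_zero_of_toMatrix_mul h)
  rw [Matrix.transpose_mul, Matrix.transpose_transpose, Matrix.transpose_zero] at hT
  exact Matrix.transpose_eq_zero.1 (p.eq_zero_of_toMatrix_mul hT)

theorem isConicFree_iff {p : SphericalPlacement V d} :
    IsConicFree G p ↔ ∀ S : Matrix (Fin d) (Fin d) ℝ, S.IsSymm →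
      (∀ i j, i = j ∨ G.Adj i j → (p.toMatrix * S * p.toMatrixᵀ) i j = 0) → S = 0 := by
  simp [IsConicFree, p.toMatrix_mul_mul_transpose_apply, or_imp, forall_and]

theorem IsUniversallyRigid.eq_gram {p : SphericalPlacement V d} (hp : IsUniversallyRigid G p)
    {X : Matrix V V ℝ} (hX : X.PosSemidef)
    (h : ∀ i j, i = j ∨ G.Adj i j → X i j = Matrix.gram ℝ p.pos i j) : X = Matrix.gram ℝ p.pos :=
  (hp X).1 ⟨hX, fun i => (h i i (Or.inl rfl)).trans (p.gram_pos_self i),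
    fun i j hij => h i j (Or.inr hij)⟩

/-- The stress of `G` whose matrix is `M`, for `M` supported on `G`. -/
def SphericalStress.ofMatrix (G : SimpleGraph V) (M : Matrix V V ℝ) (hM : M.IsSymm) :
    SphericalStress G where
  vertex i := M i i
  edge e := Sym2.lift ⟨fun i j => M i j, fun i j => hM.apply j i⟩ e.1

theorem SphericalStress.toMatrix_ofMatrix {M : Matrix V V ℝ} (hM : M.IsSymm)
    (hGM : IsSupportedOn G M) : (ofMatrix G M hM).toMatrix = M := by
  ext i j
  rw [toMatrix, Matrix.of_apply]
  split_ifs with hij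
  · subst hij; rfl
  · rw [weight]
    split_ifs with hadj
    · rfl
    · exact (hGM i j hij hadj).symm

theorem SphericalStress.isSupportedOn_toMatrix (ω : SphericalStress G) :
    IsSupportedOn G ω.toMatrix := fun i j hij hadj => by
  simp [toMatrix, weight, hij, hadj]

theorem SphericalPlacement.eventually_posSemidef_gram_add_smul [Finite V]
    (p : SphericalPlacement V d) {S : Matrix (Fin d) (Fin d) ℝ} (hS : S.IsSymm) :
    ∀ᶠ ε : ℝ in 𝓝[>] 0,
      (Matrix.gram ℝ p.pos + ε • (p.toMatrix * S * p.toMatrixᵀ)).PosSemidef := by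
  filter_upwards [eventually_posSemidef_one_add_smul hS] with ε hε
  have h := hε.mul_mul_conjTranspose_same p.toMatrix
  rwa [Matrix.mul_add, Matrix.add_mul, Matrix.mul_one, Matrix.mul_smul, Matrix.smul_mul,
    Matrix.conjTranspose_eq_transpose_of_trivial, ← p.gram_pos] at h

theorem IsUniversallyRigid.isConicFree [Finite V] {p : SphericalPlacement V d}
    (hp : IsUniversallyRigid G p) : IsConicFree G p := by
  refine isConicFree_iff.2 fun S hS hGS => p.eq_zero_of_toMatrix_mul_mul_transpose ?_
  obtain ⟨ε, hpsd, hε⟩ :=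
    ((p.eventually_posSemidef_gram_add_smul hS).and self_mem_nhdsWithin).exists
  have h := hp.eq_gram hpsd fun i j hij => by simp [hGS i j hij]
  exact (smul_eq_zero.1 (add_eq_left.1 h)).resolve_left (ne_of_gt hε)

theorem IsUniversallyRigid.mem_range_toMatrix [Finite V] (hG : IsChordalGraph G)
    {p : SphericalPlacement V d} (hp : IsUniversallyRigid G p) {v : V → ℝ}
    (hv : ∀ K : Set V, G.IsClique K → ∃ y, ∀ i ∈ K, (p.toMatrix *ᵥ y) i = v i) :
    v ∈ LinearMap.range p.toMatrix.mulVecLin := by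
  -- Subtracting `ε v vᵀ` keeps the Gram matrix positive semidefinite on every clique; rigidity then
  -- identifies any completion of the result, up to `ε v vᵀ`, with the Gram matrix.
  choose! y hy using hv
  have hlocal : ∀ᶠ ε : ℝ in 𝓝[>] 0, ∀ K : Set V, (Matrix.gram ℝ p.pos +
      ε • (p.toMatrix * (-Matrix.vecMulVec (y K) (y K)) * p.toMatrixᵀ)).PosSemidef :=
    eventually_all.2 fun K => p.eventually_posSemidef_gram_add_smul
      (by rw [Matrix.IsSymm, Matrix.transpose_neg, Matrix.transpose_vecMulVec])
  obtain ⟨ε, hpsd, hε : 0 < ε⟩ := (hlocal.and self_mem_nhdsWithin).exists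
  obtain ⟨X, hX, hXM⟩ := hG.exists_posSemidef_completion
    (Matrix.gram ℝ p.pos - ε • Matrix.vecMulVec v v) fun K hK => by
      refine ⟨_, hpsd K, fun i hi j hj => ?_⟩
      rw [Matrix.mul_neg, Matrix.neg_mul, Matrix.mul_vecMulVec, Matrix.vecMulVec_mul,
        Matrix.vecMul_transpose]
      simp [Matrix.vecMulVec_apply, hy K hK i hi, hy K hK j hj, sub_eq_add_neg]
  have hsum : X + ε • Matrix.vecMulVec v v = Matrix.gram ℝ p.pos :=
    hp.eq_gram (hX.add ((Matrix.posSemidef_vecMulVec_self_star v).smul hε.le))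
      fun i j hij => by simp [hXM i j hij]
  refine mem_range_mulVecLin_of_posSemidef_sub hε ?_
  rwa [← p.gram_pos, ← hsum, add_sub_cancel_right]

variable [Fintype V]

theorem SphericalStress.isEquilibrium_iff (ω : SphericalStress G) (p : SphericalPlacement V d) :
    ω.IsEquilibrium p ↔ ω.toMatrix * p.toMatrix = 0 := by
  classical
  have hentry : ∀ i j, ω.toMatrix i j = (if i = j then ω.vertex i else 0) + ω.weight i j := by
    intro i j
    by_cases hij : i = j <;> simp [toMatrix, weight, hij]
  have hrow : ∀ i, (ω.vertex i • p.pos i + ∑ j, ω.weight i j • p.pos j).ofLp =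
      (ω.toMatrix * p.toMatrix) i := fun i => by
    ext k
    simp [Matrix.mul_apply, hentry, add_mul, Finset.sum_add_distrib, SphericalPlacement.toMatrix]
  simp only [IsEquilibrium, ← WithLp.ofLp_eq_zero 2, hrow]
  exact funext_iff.symm

theorem range_mulVecLin_le_ker_iff {l m n : Type*} [Fintype m] [Fintype n] {A : Matrix l m ℝ}
    {B : Matrix m n ℝ} :
    LinearMap.range B.mulVecLin ≤ LinearMap.ker A.mulVecLin ↔ A * B = 0 := by
  classical
  rw [LinearMap.range_le_ker_iff, ← Matrix.mulVecLin_mul, ← Matrix.toLin'_apply',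
    LinearEquiv.map_eq_zero_iff]

theorem isSuperStable_iff {p : SphericalPlacement V d} :
    IsSuperStable G p ↔ (∃ M : Matrix V V ℝ, M.PosSemidef ∧ IsSupportedOn G M ∧
      LinearMap.ker M.mulVecLin = LinearMap.range p.toMatrix.mulVecLin) ∧ IsConicFree G p := by
  refine and_congr_left fun _ => ⟨?_, ?_⟩
  · rintro ⟨ω, heq, hpsd, hrank⟩
    refine ⟨ω.toMatrix, hpsd, ω.isSupportedOn_toMatrix,
      (Submodule.eq_of_le_of_finrank_eq ?_ ?_).symm⟩
    · exact range_mulVecLin_le_ker_iff.2 ((ω.isEquilibrium_iff p).1 heq)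
    · rw [hrank, p.finrank_range_toMatrix]
  · rintro ⟨M, hpsd, hGM, hker⟩
    have hsymm : M.IsSymm := Matrix.isHermitian_iff_isSymm.1 hpsd.isHermitian
    have hM := SphericalStress.toMatrix_ofMatrix hsymm hGM
    refine ⟨SphericalStress.ofMatrix G M hsymm, ?_, hM.symm ▸ hpsd, ?_⟩
    · rw [SphericalStress.isEquilibrium_iff, hM, ← range_mulVecLin_le_ker_iff, hker]
    · rw [hM, hker, p.finrank_range_toMatrix]

theorem IsUniversallyRigid.isSuperStable (hG : IsChordalGraph G) {p : SphericalPlacement V d}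
    (hp : IsUniversallyRigid G p) : IsSuperStable G p := by
  obtain ⟨M, hM, hGM, hker⟩ :=
    exists_posSemidef_isSupportedOn_ker G (LinearMap.range p.toMatrix.mulVecLin)
  refine isSuperStable_iff.2 ⟨⟨M, hM, hGM, le_antisymm (fun x hx => ?_) fun x hx => ?_⟩,
    hp.isConicFree⟩
  · refine hp.mem_range_toMatrix hG fun K hK => ?_
    obtain ⟨_, ⟨y, rfl⟩, hy⟩ := (hker x).1 hx K hK
    exact ⟨y, hy⟩
  · exact (hker x).2 fun K _ => ⟨x, hx, fun i _ => rfl⟩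

end Placement

section Contraction

open scoped Matrix

variable {V W : Type*} {G : SimpleGraph V} {d : ℕ}

theorem row_eq_of_apply_eq_one [Finite V] {X : Matrix V V ℝ} (hX : X.PosSemidef)
    (hdiag : ∀ i, X i i = 1) {i j : V} (hij : X i j = 1) : X i = X j := by
  cases nonempty_fintype V
  obtain ⟨x, rfl⟩ := exists_gram_eq_of_posSemidef hX
  have hnorm : ∀ k, ‖x k‖ = 1 := fun k => by
    rw [← pow_eq_one_iff_of_nonneg (norm_nonneg _) two_ne_zero, ← real_inner_self_eq_norm_sq]
    exact hdiag k
  have hx : x i = x j := (inner_eq_one_iff_of_norm_eq_one (𝕜 := ℝ) (hnorm i) (hnorm j)).1 hij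
  ext k
  rw [Matrix.gram_apply, Matrix.gram_apply, hx]

/-- Places every vertex `v` at the point of `f v`. -/
def SphericalPlacement.comap (p : SphericalPlacement W d) {f : V → W}
    (hf : Function.Surjective f) : SphericalPlacement V d where
  pos := p.pos ∘ f
  norm_pos v := p.norm_pos (f v)
  span_pos := by rw [hf.range_comp, p.span_pos]

theorem isUniversallyRigid_of_forall_eq_gram [Finite V] {p : SphericalPlacement V d}
    (h : ∀ X : Matrix V V ℝ, X.PosSemidef → (∀ i, X i i = 1) →
      (∀ i j, G.Adj i j → X i j = Matrix.gram ℝ p.pos i j) → X = Matrix.gram ℝ p.pos) :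
    IsUniversallyRigid G p := fun X =>
  ⟨fun hX => h X hX.1 hX.2.1 hX.2.2, by
    rintro rfl
    exact ⟨Matrix.posSemidef_gram ℝ _, p.gram_pos_self, fun _ _ _ => rfl⟩⟩

theorem IsUniversallyRigid.comap [Finite V] {f : V → W} (hf : Function.Surjective f)
    (hfib : ∀ u v, f u = f v → u = v ∨ G.Adj u v) {p : SphericalPlacement W d}
    (hp : IsUniversallyRigid (G.map f) p) : IsUniversallyRigid G (p.comap hf) := by
  refine isUniversallyRigid_of_forall_eq_gram fun X hX hdiag hedge => ?_
  have hrow : ∀ u v, f u = f v → X u = X v := fun u v huv => by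
    obtain rfl | hadj := hfib u v huv
    · rfl
    · refine row_eq_of_apply_eq_one hX hdiag ?_
      rw [hedge u v hadj, ← p.gram_pos_self (f u)]
      exact congrArg (fun w => Matrix.gram ℝ p.pos (f u) w) huv.symm
  have hcol : ∀ u v i, f u = f v → X i u = X i v := fun u v i huv => by
    rw [← hX.isHermitian.apply i u, ← hX.isHermitian.apply i v, hrow u v huv]
  obtain ⟨g, hg⟩ := hf.hasRightInverse
  have hX_factor : ∀ u v, X u v = X.submatrix g g (f u) (f v) := fun u v => by
    rw [Matrix.submatrix_apply, hrow _ u (hg _), hcol _ v u (hg _)]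
  have hgram : X.submatrix g g = Matrix.gram ℝ p.pos := by
    refine hp.eq_gram (hX.submatrix g) fun i j hij => ?_
    obtain rfl | ⟨-, u, v, huv, rfl, rfl⟩ := hij
    · rw [Matrix.submatrix_apply, hdiag, p.gram_pos_self]
    · rw [← hX_factor, hedge u v huv]
      rfl
  ext u v
  rw [hX_factor, hgram]
  rfl

theorem IsConicFree.of_comap {f : V → W} {hf : Function.Surjective f}
    {p : SphericalPlacement W d} (h : IsConicFree G (p.comap hf)) : IsConicFree (G.map f) p := by
  refine fun S hS hdiag hedge => h S hS (fun i => hdiag (f i)) fun i j hij => ?_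
  by_cases hf_eq : f i = f j
  · change (p.pos (f i)).ofLp ⬝ᵥ S *ᵥ (p.pos (f j)).ofLp = 0
    rw [← hf_eq, hdiag]
  · exact hedge _ _ ⟨hf_eq, i, j, hij, rfl, rfl⟩

theorem IsSuperStable.of_comap [Fintype V] [Fintype W] {f : V → W} {hf : Function.Surjective f}
    {p : SphericalPlacement W d} (h : IsSuperStable G (p.comap hf)) :
    IsSuperStable (G.map f) p := by
  classical
  obtain ⟨⟨M, hM, hGM, hker⟩, hconic⟩ := isSuperStable_iff.1 h
  let A : Matrix V W ℝ := Matrix.of fun v w => if f v = w then 1 else 0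
  have hA : ∀ y, A *ᵥ y = y ∘ f := fun y => by
    ext v
    simp [A, Matrix.mulVec, dotProduct]
  refine isSuperStable_iff.2 ⟨⟨Aᴴ * M * A, hM.conjTranspose_mul_mul_same A, ?_, ?_⟩,
    hconic.of_comap⟩
  · intro i j hij hadj
    simp only [Matrix.mul_apply, Finset.sum_mul]
    refine Finset.sum_eq_zero fun v _ => Finset.sum_eq_zero fun u _ => ?_
    by_cases hu : f u = i
    · by_cases hv : f v = j
      · have huv : ¬ G.Adj u v := fun huv => hadj ⟨hij, u, v, huv, hu, hv⟩
        rw [hGM u v (fun h => hij (by rw [← hu, ← hv, h])) huv, mul_zero, zero_mul]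
      · simp [A, hv]
    · simp [A, hu]
  · ext y
    have hzero : (Aᴴ * M * A) *ᵥ y = 0 ↔ M *ᵥ (y ∘ f) = 0 := by
      rw [← (hM.conjTranspose_mul_mul_same A).dotProduct_mulVec_zero_iff, ← hA,
        ← hM.dotProduct_mulVec_zero_iff, ← Matrix.mulVec_mulVec, ← Matrix.mulVec_mulVec,
        Matrix.dotProduct_mulVec, ← Matrix.star_mulVec]
    rw [LinearMap.mem_ker, Matrix.mulVecLin_apply, hzero, ← Matrix.mulVecLin_apply,
      ← LinearMap.mem_ker, hker]
    refine exists_congr fun z => ?_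
    exact hf.injective_comp_right.eq_iff (a := p.toMatrix *ᵥ z) (b := y)

/-- Every universally rigid framework on `G` is super stable, in every dimension. -/
def RigidImpliesSuperStable [Fintype V] (G : SimpleGraph V) : Prop :=
  ∀ (d : ℕ) (p : SphericalPlacement V d), IsUniversallyRigid G p → IsSuperStable G p

theorem RigidImpliesSuperStable.map [Fintype V] [Fintype W] {f : V → W}
    (hG : RigidImpliesSuperStable G) (hf : Function.Surjective f)
    (hfib : ∀ u v, f u = f v → u = v ∨ G.Adj u v) : RigidImpliesSuperStable (G.map f) :=
  fun d p hp => (hG d (p.comap hf) (hp.comap hf hfib)).of_comap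

end Contraction

section Simplex

open scoped Matrix RealInnerProductSpace

variable {V : Type*} {G : SimpleGraph V} {d : ℕ}

theorem eq_gram_of_apply_basis [Finite V] {p : SphericalPlacement V d} {r : Fin d → V}
    (hr : ∀ j, p.pos (r j) = EuclideanSpace.single j 1) {X : Matrix V V ℝ} (hX : X.PosSemidef)
    (hdiag : ∀ i, X i i = 1) (h : ∀ i j, X i (r j) = p.pos i j) :
    X = Matrix.gram ℝ p.pos := by
  cases nonempty_fintype V
  obtain ⟨x, rfl⟩ := exists_gram_eq_of_posSemidef hX
  have hz : Orthonormal ℝ (x ∘ r) := by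
    classical
    refine orthonormal_iff_ite.2 fun j k => ?_
    refine (h (r j) k).trans ?_
    simp [hr, eq_comm]
  have hnorm : ∀ i, ‖x i‖ = ‖p.pos i‖ := fun i => by
    rw [← sq_eq_sq₀ (norm_nonneg _) (norm_nonneg _), ← real_inner_self_eq_norm_sq, p.norm_pos,
      one_pow]
    exact hdiag i
  have hx : ∀ i, x i = ∑ j, p.pos i j • x (r j) := fun i =>
    eq_sum_smul_of_orthonormal hz (hnorm i) (h i)
  ext i k
  rw [Matrix.gram_apply, Matrix.gram_apply, hx i, hx k]
  refine (hz.inner_sum _ _ _).trans ?_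
  simp [PiLp.inner_apply, mul_comm]

/-- The vertices `e_j` of the standard simplex, together with its barycenter rescaled to the unit
sphere, as the value at `none`. -/
noncomputable def simplexPoint (d : ℕ) : Option (Fin d) → EuclideanSpace ℝ (Fin d)
  | some j => EuclideanSpace.single j 1
  | none => WithLp.toLp 2 fun _ => (√(d : ℝ))⁻¹

/-- A coloring of the vertices by the simplex points whose classes at the vertices of the simplex
are cliques, with an edge between any two of them, and in which every vertex at the barycenter is
adjacent to all of these classes. -/
structure IsBarycentricColoring (G : SimpleGraph V) (τ : V → Option (Fin d)) : Prop where
  adj_of_eq : ∀ ⦃u v j⦄, τ u = some j → τ v = some j → u = v ∨ G.Adj u v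
  exists_adj : ∀ ⦃j k⦄, j ≠ k → ∃ u v, τ u = some j ∧ τ v = some k ∧ G.Adj u v
  exists_adj_of_none : ∀ ⦃v⦄, τ v = none → ∀ j, ∃ w, τ w = some j ∧ G.Adj v w

variable [NeZero d]

theorem norm_simplexPoint (c : Option (Fin d)) : ‖simplexPoint d c‖ = 1 := by
  cases c with
  | some j => simp [simplexPoint]
  | none =>
    have hd : (d : ℝ) ≠ 0 := NeZero.ne _
    simp [simplexPoint, EuclideanSpace.norm_eq, hd]

/-- The placement at the simplex points given by a coloring `τ` that uses every vertex of the
simplex. -/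
noncomputable def simplexPlacement (τ : V → Option (Fin d)) (hτ : ∀ j, ∃ v, τ v = some j) :
    SphericalPlacement V d where
  pos v := simplexPoint d (τ v)
  norm_pos v := norm_simplexPoint (τ v)
  span_pos := by
    rw [eq_top_iff, ← (EuclideanSpace.basisFun (Fin d) ℝ).toBasis.span_eq]
    refine Submodule.span_mono ?_
    rintro _ ⟨j, rfl⟩
    obtain ⟨v, hv⟩ := hτ j
    exact ⟨v, by simp [hv, simplexPoint]⟩

theorem IsBarycentricColoring.isUniversallyRigid [Finite V] {τ : V → Option (Fin d)}
    (hG : IsBarycentricColoring G τ) (hτ : ∀ j, ∃ v, τ v = some j) :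
    IsUniversallyRigid G (simplexPlacement τ hτ) := by
  cases nonempty_fintype V
  refine isUniversallyRigid_of_forall_eq_gram fun X hX hdiag hedge => ?_
  have hgram : ∀ u v j, τ v = some j →
      Matrix.gram ℝ (simplexPlacement τ hτ).pos u v = simplexPoint d (τ u) j := by
    intro u v j hv
    change ⟪simplexPoint d (τ u), simplexPoint d (τ v)⟫ = _
    rw [hv]
    exact (EuclideanSpace.inner_single_right j 1 _).trans (one_mul _)
  have hrow : ∀ u v j, τ u = some j → τ v = some j → X u = X v := by
    intro u v j hu hv
    obtain rfl | huv := hG.adj_of_eq hu hv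
    · rfl
    · refine row_eq_of_apply_eq_one hX hdiag ?_
      rw [hedge u v huv, hgram u v j hv, hu]
      simp [simplexPoint]
  have hcol : ∀ i u v j, τ u = some j → τ v = some j → X i u = X i v := fun i u v j hu hv => by
    rw [← hX.isHermitian.apply i u, ← hX.isHermitian.apply i v, hrow u v j hu hv]
  choose r hr using id hτ
  refine eq_gram_of_apply_basis (r := r)
    (fun j => congrArg (simplexPoint d) (hr j)) hX hdiag fun i j => ?_
  change X i (r j) = simplexPoint d (τ i) j
  cases hi : τ i with
  | some k =>
    obtain rfl | hkj := eq_or_ne k j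
    · rw [hcol i (r k) i k (hr k) hi, hdiag]
      simp [simplexPoint]
    · obtain ⟨u, v, hu, hv, huv⟩ := hG.exists_adj hkj
      rw [hrow i u k hi hu, hcol u (r j) v j (hr j) hv, hedge u v huv, hgram u v j hv, hu]
  | none =>
    obtain ⟨w, hw, hiw⟩ := hG.exists_adj_of_none hi j
    rw [hcol i (r j) w j (hr j) hw, hedge i w hiw, hgram i w j hw, hi]

theorem toMatrix_simplexPlacement_mulVec {τ : V → Option (Fin d)} (hτ : ∀ j, ∃ v, τ v = some j)
    (j : Fin d) : (simplexPlacement τ hτ).toMatrix *ᵥ Pi.single j 1 =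
      Set.indicator (τ ⁻¹' {some j}) 1 + (√(d : ℝ))⁻¹ • Set.indicator (τ ⁻¹' {none}) 1 := by
  classical
  ext v
  cases hv : τ v <;>
    simp [hv, SphericalPlacement.toMatrix, simplexPlacement, simplexPoint, Set.indicator_apply,
      eq_comm]

theorem mulVec_indicator_apply_eq_zero [Fintype V] {M : Matrix V V ℝ} (hGM : IsSupportedOn G M)
    {v : V} {S : Set V} (hv : v ∉ S) (h : ∀ u ∈ S, ¬ G.Adj v u) :
    (M *ᵥ Set.indicator S 1) v = 0 := by
  refine Finset.sum_eq_zero fun u _ => ?_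
  by_cases hu : u ∈ S
  · exact mul_eq_zero_of_left (hGM v u (fun huv => hv (huv ▸ hu)) (h u hu)) _
  · rw [Set.indicator_of_notMem hu, mul_zero]

theorem indicator_notMem_range_toMatrix_simplexPlacement {τ : V → Option (Fin d)}
    (hτ : ∀ j, ∃ v, τ v = some j) {v₀ : V} (hv₀ : τ v₀ = none) (j₀ : Fin d) :
    Set.indicator (τ ⁻¹' {some j₀}) 1 ∉
      LinearMap.range (simplexPlacement τ hτ).toMatrix.mulVecLin := by
  classical
  rintro ⟨y, hy⟩
  have hyj : y = Pi.single j₀ 1 := by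
    ext j
    obtain ⟨v, hv⟩ := hτ j
    simpa [SphericalPlacement.toMatrix, Matrix.mulVec, dotProduct, simplexPlacement, simplexPoint,
      hv, Set.indicator_apply, Pi.single_apply] using congrFun hy v
  have hbary := congrFun hy v₀
  rw [hyj, Matrix.mulVecLin_apply, toMatrix_simplexPlacement_mulVec] at hbary
  simp [hv₀, NeZero.ne d] at hbary

theorem simplexPlacement_not_isSuperStable [Fintype V] {τ : V → Option (Fin d)}
    (hτ : ∀ j, ∃ v, τ v = some j) {v₀ : V} (hv₀ : τ v₀ = none) {j₀ : Fin d}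
    (hmiss : ∀ v, τ v = some j₀ → ∃ c ≠ some j₀, ∀ u, τ u = c → ¬ G.Adj v u) :
    ¬ IsSuperStable G (simplexPlacement τ hτ) := by
  intro hstable
  obtain ⟨⟨M, hM, hGM, hker⟩, -⟩ := isSuperStable_iff.1 hstable
  let ind (c : Option (Fin d)) : V → ℝ := Set.indicator (τ ⁻¹' {c}) 1
  -- All `M *ᵥ ind (some j)` are the same multiple of `M *ᵥ ind none`. At a vertex `v` of color `j₀`
  -- one of these vectors vanishes, hence all of them do.
  have hrel : ∀ j, M *ᵥ ind (some j) + (√(d : ℝ))⁻¹ • M *ᵥ ind none = 0 := by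
    intro j
    have hmem : (simplexPlacement τ hτ).toMatrix *ᵥ Pi.single j 1 ∈ LinearMap.ker M.mulVecLin :=
      hker ▸ LinearMap.mem_range_self _ _
    rwa [toMatrix_simplexPlacement_mulVec, LinearMap.mem_ker, Matrix.mulVecLin_apply,
      Matrix.mulVec_add, Matrix.mulVec_smul] at hmem
  have hvanish : ∀ v, τ v = some j₀ → (M *ᵥ ind (some j₀)) v = 0 := by
    intro v hv
    obtain ⟨c, hc, hmiss⟩ := hmiss v hv
    have hzero : (M *ᵥ ind c) v = 0 :=
      mulVec_indicator_apply_eq_zero hGM (fun h => hc (h.symm.trans hv)) hmiss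
    have hnone : (M *ᵥ ind none) v = 0 := by
      cases c with
      | none => exact hzero
      | some j => simpa [hzero, NeZero.ne d] using congrFun (hrel j) v
    simpa [hnone] using congrFun (hrel j₀) v
  have hind : M *ᵥ ind (some j₀) = 0 := by
    rw [← hM.dotProduct_mulVec_zero_iff]
    refine Finset.sum_eq_zero fun v _ => ?_
    by_cases hv : τ v = some j₀
    · rw [hvanish v hv, mul_zero]
    · simp [ind, hv]
  exact indicator_notMem_range_toMatrix_simplexPlacement hτ hv₀ j₀
    (hker ▸ LinearMap.mem_ker.2 hind)

theorem IsBarycentricColoring.not_rigidImpliesSuperStable [Fintype V] {τ : V → Option (Fin d)}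
    (hG : IsBarycentricColoring G τ) {v₀ : V} (hv₀ : τ v₀ = none) {j₀ : Fin d}
    (hmiss : ∀ v, τ v = some j₀ → ∃ c ≠ some j₀, ∀ u, τ u = c → ¬ G.Adj v u) :
    ¬ RigidImpliesSuperStable G := fun hstable =>
  have hτ : ∀ j, ∃ v, τ v = some j := fun j =>
    (hG.exists_adj_of_none hv₀ j).imp fun _ hw => hw.1
  simplexPlacement_not_isSuperStable hτ hv₀ hmiss (hstable d _ (hG.isUniversallyRigid hτ))

end Simplex

section ConnectedChordal

open SimpleGraph

variable {V : Type*} {G : SimpleGraph V} {a b : V}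

open Classical in
/-- The map that moves `b` to `a` and fixes all other vertices, onto the vertices other
than `b`. -/
noncomputable def contractionMap (hab : G.Adj a b) (v : V) : {v : V // v ≠ b} :=
  if hv : v = b then ⟨a, hab.ne⟩ else ⟨v, hv⟩

/-- The graph obtained from `G` by contracting the edge `ab`; the new vertex is called `a`. -/
noncomputable def edgeContraction (hab : G.Adj a b) : SimpleGraph {v : V // v ≠ b} :=
  G.map (contractionMap hab)

theorem contractionMap_self (hab : G.Adj a b) : contractionMap hab b = ⟨a, hab.ne⟩ :=
  dif_pos rfl

theorem contractionMap_of_ne (hab : G.Adj a b) {v : V} (hv : v ≠ b) :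
    contractionMap hab v = ⟨v, hv⟩ :=
  dif_neg hv

theorem contractionMap_surjective (hab : G.Adj a b) : Function.Surjective (contractionMap hab) :=
  fun v => ⟨v, contractionMap_of_ne hab v.2⟩

theorem contractionMap_eq_iff (hab : G.Adj a b) {u : V} {v : {v : V // v ≠ b}} :
    contractionMap hab u = v ↔ u = v ∨ u = b ∧ v.1 = a := by
  obtain rfl | hu := eq_or_ne u b
  · rw [contractionMap_self, Subtype.ext_iff]
    simp [v.2.symm, eq_comm]
  · simp [contractionMap_of_ne hab hu, Subtype.ext_iff, hu]

theorem eq_or_adj_of_contractionMap_eq (hab : G.Adj a b) {u v : V}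
    (h : contractionMap hab u = contractionMap hab v) : u = v ∨ G.Adj u v := by
  obtain rfl | hv := eq_or_ne v b
  · rw [contractionMap_self, contractionMap_eq_iff] at h
    obtain rfl | ⟨rfl, -⟩ := h
    exacts [Or.inr hab, Or.inl rfl]
  · rw [contractionMap_of_ne hab hv, contractionMap_eq_iff] at h
    obtain rfl | ⟨rfl, rfl⟩ := h
    exacts [Or.inl rfl, Or.inr hab.symm]

theorem edgeContraction_adj (hab : G.Adj a b) {u v : {v : V // v ≠ b}} :
    (edgeContraction hab).Adj u v ↔
      u ≠ v ∧ (G.Adj u v ∨ u.1 = a ∧ G.Adj b v ∨ v.1 = a ∧ G.Adj u b) := by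
  rw [edgeContraction, map_adj']
  simp only [contractionMap_eq_iff, and_congr_right_iff]
  refine fun huv => ⟨?_, ?_⟩
  · rintro ⟨u', v', hadj, rfl | ⟨rfl, hu⟩, rfl | ⟨rfl, hv⟩⟩
    exacts [Or.inl hadj, Or.inr (Or.inr ⟨hv, hadj⟩), Or.inr (Or.inl ⟨hu, hadj⟩),
      absurd hadj G.irrefl]
  · rintro (hadj | ⟨hu, hadj⟩ | ⟨hv, hadj⟩)
    exacts [⟨u, v, hadj, Or.inl rfl, Or.inl rfl⟩, ⟨b, v, hadj, Or.inr ⟨rfl, hu⟩, Or.inl rfl⟩,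
      ⟨u, b, hadj, Or.inl rfl, Or.inr ⟨rfl, hv⟩⟩]

theorem connected_map {W : Type*} {f : V → W} (hG : G.Connected) (hf : Function.Surjective f) :
    (G.map f).Connected := by
  have := hG.nonempty.map f
  refine ⟨fun x y => ?_⟩
  obtain ⟨⟨u, rfl⟩, v, rfl⟩ := hf x, hf y
  by_contra h
  obtain ⟨i, hi, j, hj, hij⟩ := exists_boundary_adj_of_reachable (hG.preconnected u v)
    (S := {w | (G.map f).Reachable (f u) (f w)}) (Reachable.refl _) h
  obtain heq | hne := eq_or_ne (f i) (f j)
  · exact hj (show (G.map f).Reachable (f u) (f j) from heq ▸ hi)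
  · exact hj (Reachable.trans hi (Adj.reachable ⟨hne, i, j, hij, rfl, rfl⟩))

/-- Contracting any edge of `G` leaves a chordal graph. -/
def IsContractionChordal (G : SimpleGraph V) : Prop :=
  ∀ ⦃a b⦄ (hab : G.Adj a b), IsChordalGraph (edgeContraction hab)

theorem IsContractionChordal.isEmpty_embedding (hG : IsContractionChordal G) {n : ℕ} (hn : 5 ≤ n) :
    IsEmpty (cycleGraph n ↪g G) := by
  refine ⟨fun e => ?_⟩
  obtain ⟨n, rfl⟩ : ∃ k, n = k + 2 := ⟨n - 2, by omega⟩
  have hadj : ∀ i j : Fin (n + 2), i < j → (G.Adj (e i) (e j) ↔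
      (j.val = i.val + 1 ∨ (i.val = 0 ∧ j.val = n + 1))) := fun i j hij =>
    e.map_adj_iff.trans (cycleGraph_adj_of_lt hij)
  have hab : G.Adj (e (Fin.last n).castSucc) (e (Fin.last (n + 1))) :=
    (hadj _ _ (Fin.castSucc_lt_last _)).2 (Or.inl rfl)
  have hne : ∀ i : Fin (n + 1), e i.castSucc ≠ e (Fin.last (n + 1)) := fun i =>
    e.injective.ne (Fin.castSucc_lt_last i).ne
  obtain ⟨contracted⟩ := nonempty_cycleGraph_embedding (G := edgeContraction hab)
    (fun i : Fin (n + 1) => ⟨e i.castSucc, hne i⟩) fun i j hij => by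
      have hij' : i.castSucc < j.castSucc := hij
      have : i.val < j.val := hij
      have hlast : ∀ k : Fin (n + 1), e k.castSucc = e (Fin.last n).castSucc ↔ k.val = n :=
        fun k => e.injective.eq_iff.trans (by simp [Fin.ext_iff])
      have hb : ∀ k : Fin (n + 1), G.Adj (e k.castSucc) (e (Fin.last (n + 1))) ↔
          (k.val = n ∨ k.val = 0) := fun k =>
        (hadj _ _ (Fin.castSucc_lt_last k)).trans (by simp; omega)
      refine ⟨fun h => hij'.ne (e.injective (Subtype.ext_iff.1 h)), ?_⟩
      rw [edgeContraction_adj, and_iff_right fun h => hij'.ne (e.injective (Subtype.ext_iff.1 h)),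
        hadj _ _ hij', hlast, hlast, G.adj_comm (e (Fin.last (n + 1))), hb, hb]
      simp only [Fin.val_castSucc]
      omega
  exact (hG hab (n + 1) (by omega)).false contracted

/-- `x u y v` is an induced 4-cycle of `G`, with diagonals `xy` and `uv`. -/
structure IsInducedSquare (G : SimpleGraph V) (x u y v : V) : Prop where
  adj_xu : G.Adj x u
  adj_uy : G.Adj u y
  adj_yv : G.Adj y v
  adj_vx : G.Adj v x
  not_adj_xy : ¬ G.Adj x y
  not_adj_uv : ¬ G.Adj u v
  x_ne_y : x ≠ y
  u_ne_v : u ≠ v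

theorem IsInducedSquare.rotate {x u y v : V} (h : IsInducedSquare G x u y v) :
    IsInducedSquare G u y v x :=
  ⟨h.adj_uy, h.adj_yv, h.adj_vx, h.adj_xu, h.not_adj_uv, fun hyx => h.not_adj_xy hyx.symm,
    h.u_ne_v, h.x_ne_y.symm⟩

theorem rotate_notMem {x u y v w : V} (hw : w ∉ ({x, u, y, v} : Set V)) :
    w ∉ ({u, y, v, x} : Set V) := by
  grind

theorem isInducedSquare_of_embedding (e : cycleGraph 4 ↪g G) :
    IsInducedSquare G (e 0) (e 1) (e 2) (e 3) := by
  constructor <;> first | rw [e.map_adj_iff] | refine e.injective.ne ?_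
  all_goals decide

theorem IsInducedSquare.not_isChordalGraph {x u y v : V} (h : IsInducedSquare G x u y v) :
    ¬ IsChordalGraph G := by
  obtain ⟨e⟩ := nonempty_cycleGraph_embedding (G := G) ![x, u, y, v] fun i j hij => by
    obtain ⟨hxu, huy, hyv, hvx, hxy, huv, hxy', huv'⟩ := h
    fin_cases i <;> fin_cases j <;> simp_all [hxu.ne, huy.ne, hyv.ne, hvx.ne', G.adj_comm x v]
  exact fun hG => (hG 4 le_rfl).false e

theorem IsContractionChordal.exists_mem_square_adj (hG : IsContractionChordal G) {x u y v : V}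
    (h : IsInducedSquare G x u y v) (hab : G.Adj a b) (hb : b ∉ ({x, u, y, v} : Set V)) :
    a ∈ ({x, u, y, v} : Set V) ∧ ∃ t ∈ ({x, u, y, v} : Set V), G.Adj b t ∧ t ≠ a ∧ ¬ G.Adj a t := by
  -- Otherwise the square survives the contraction of `ab`.
  by_contra hno
  simp only [Set.mem_insert_iff, Set.mem_singleton_iff, not_or] at hb
  obtain ⟨hx, hu, hy, hv⟩ := hb
  have hsq : IsInducedSquare (edgeContraction hab) ⟨x, Ne.symm hx⟩ ⟨u, Ne.symm hu⟩ ⟨y, Ne.symm hy⟩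
      ⟨v, Ne.symm hv⟩ := by
    have hcomm := G.adj_comm
    simp only [Set.mem_insert_iff, Set.mem_singleton_iff] at hno
    obtain ⟨hxu, huy, hyv, hvx, hxy, huv, hxy', huv'⟩ := h
    constructor <;> simp only [edgeContraction_adj, ne_eq, Subtype.mk.injEq] <;> grind
  exact hsq.not_isChordalGraph (hG hab)

theorem IsContractionChordal.adj_opposite (hG : IsContractionChordal G) {x u y v w : V}
    (h : IsInducedSquare G x u y v) (hw : w ∉ ({x, u, y, v} : Set V)) (hwx : G.Adj w x) :
    G.Adj w y := by
  obtain ⟨-, t, ht, hwt, htx, hxt⟩ := hG.exists_mem_square_adj h hwx.symm hw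
  obtain rfl | rfl | rfl | rfl := ht
  exacts [absurd rfl htx, absurd h.adj_xu hxt, hwt, absurd h.adj_vx.symm hxt]

theorem IsContractionChordal.adj_diagonal (hG : IsContractionChordal G) (hconn : G.Connected)
    {x u y v w : V} (h : IsInducedSquare G x u y v) (hw : w ∉ ({x, u, y, v} : Set V)) :
    G.Adj w x ∧ G.Adj w y ∨ G.Adj w u ∧ G.Adj w v := by
  have hwx : w ≠ x := fun hwx => hw (Or.inl hwx)
  obtain ⟨_, rfl, t, -, hwt⟩ := exists_boundary_adj_of_reachable (hconn.preconnected w x)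
    (Set.mem_singleton w) (Ne.symm hwx)
  have hw' := rotate_notMem hw
  obtain rfl | rfl | rfl | rfl := (hG.exists_mem_square_adj h hwt.symm hw).1
  · exact Or.inl ⟨hwt, hG.adj_opposite h hw hwt⟩
  · exact Or.inr ⟨hwt, hG.adj_opposite h.rotate hw' hwt⟩
  · exact Or.inl ⟨hG.adj_opposite h.rotate.rotate (rotate_notMem hw') hwt, hwt⟩
  · exact Or.inr
      ⟨hG.adj_opposite h.rotate.rotate.rotate (rotate_notMem (rotate_notMem hw')) hwt, hwt⟩

theorem IsContractionChordal.forall_adj_diagonal (hG : IsContractionChordal G)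
    (hconn : G.Connected) {x u y v : V} (h : IsInducedSquare G x u y v)
    (hw : ∃ w, w ∉ ({x, u, y, v} : Set V) ∧ G.Adj w x ∧ G.Adj w y ∧ ¬ G.Adj w u) :
    ∀ w, w ∉ ({x, u, y, v} : Set V) → G.Adj w x ∧ G.Adj w y ∧ ¬ G.Adj w u := by
  obtain ⟨w₀, hw₀, hx₀, hy₀, hu₀⟩ := hw
  have hv₀ : ¬ G.Adj w₀ v := fun hv₀ => hu₀ <|
    hG.adj_opposite h.rotate.rotate.rotate (rotate_notMem (rotate_notMem (rotate_notMem hw₀))) hv₀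
  -- Replacing `u` by `w₀` gives a second square, with which any neighbor of `u` must interact.
  have h' : IsInducedSquare G x w₀ y v := { h with
    adj_xu := hx₀.symm
    adj_uy := hy₀
    not_adj_uv := hv₀
    u_ne_v := fun hv => hw₀ (by simp [hv]) }
  intro w hw
  obtain rfl | hne := eq_or_ne w w₀
  · exact ⟨hx₀, hy₀, hu₀⟩
  have hw' : w ∉ ({x, w₀, y, v} : Set V) := by grind
  have hu' : u ∉ ({x, w₀, y, v} : Set V) := by
    have := h.adj_xu.ne
    have := h.adj_uy.ne
    have := h.u_ne_v
    grind
  have hwu : ¬ G.Adj w u := fun hwu => hw' (hG.exists_mem_square_adj h' hwu hu').1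
  obtain ⟨hx, hy⟩ | ⟨hu, -⟩ := hG.adj_diagonal hconn h hw
  · exact ⟨hx, hy, hwu⟩
  · exact absurd hu hwu

theorem IsContractionChordal.exists_square (hG : IsContractionChordal G) (hconn : G.Connected)
    {x u y v : V} (h : IsInducedSquare G x u y v) :
    (∃ x u y v, IsInducedSquare G x u y v ∧
      ∀ w, w ∉ ({x, u, y, v} : Set V) → G.Adj w x ∧ G.Adj w y ∧ ¬ G.Adj w u) ∨
    ∃ w, w ∉ ({x, u, y, v} : Set V) ∧
      ∀ w, w ∉ ({x, u, y, v} : Set V) → G.Adj w x ∧ G.Adj w y ∧ G.Adj w v := by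
  by_cases hxy : ∃ w, w ∉ ({x, u, y, v} : Set V) ∧ G.Adj w x ∧ G.Adj w y ∧ ¬ G.Adj w u
  · exact Or.inl ⟨x, u, y, v, h, hG.forall_adj_diagonal hconn h hxy⟩
  by_cases huv : ∃ w, w ∉ ({u, y, v, x} : Set V) ∧ G.Adj w u ∧ G.Adj w v ∧ ¬ G.Adj w y
  · exact Or.inl ⟨u, y, v, x, h.rotate, hG.forall_adj_diagonal hconn h.rotate huv⟩
  have hfull : ∀ w, w ∉ ({x, u, y, v} : Set V) → G.Adj w x ∧ G.Adj w y ∧ G.Adj w v := by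
    intro w hw
    push Not at hxy huv
    have hw' := rotate_notMem hw
    obtain ⟨hx, hy⟩ | ⟨hu, hv⟩ := hG.adj_diagonal hconn h hw
    · exact ⟨hx, hy, hG.adj_opposite h.rotate hw' (hxy w hw hx hy)⟩
    · have hy := huv w hw' hu hv
      exact ⟨hG.adj_opposite h.rotate.rotate (rotate_notMem hw') hy, hy, hv⟩
  by_cases hout : ∃ w, w ∉ ({x, u, y, v} : Set V)
  · exact Or.inr (hout.imp fun w hw => ⟨hw, hfull⟩)
  · push Not at hout
    exact Or.inl ⟨x, u, y, v, h, fun w hw => absurd (hout w) hw⟩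

end ConnectedChordal

section Converse

variable {V : Type*} [Fintype V] {G : SimpleGraph V} {x u y v : V}

theorem IsInducedSquare.not_rigidImpliesSuperStable_of_diagonal (h : IsInducedSquare G x u y v)
    (hout : ∀ w, w ∉ ({x, u, y, v} : Set V) → G.Adj w x ∧ G.Adj w y ∧ ¬ G.Adj w u) :
    ¬ RigidImpliesSuperStable G := by
  classical
  obtain ⟨hxu, huy, hyv, hvx, hxy, huv, hxy', huv'⟩ := h
  have hcomm := G.adj_comm
  let τ : V → Option (Fin 2) := fun w =>
    if w = x ∨ w = u then some 0 else if w = y then some 1 else none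
  have hx : τ x = some 0 := by grind
  have hu : τ u = some 0 := by grind
  have hy : τ y = some 1 := by grind
  have hv : τ v = none := by grind
  have hzero {w : V} (hw : τ w = some 0) : w = x ∨ w = u := by grind
  have hone {w : V} (hw : τ w = some 1) : w = y := by grind
  have hnone {w : V} (hw : τ w = none) : G.Adj w x ∧ G.Adj w y ∧ ¬ G.Adj w u := by grind
  have hτ : IsBarycentricColoring G τ := by
    refine ⟨fun s t j hs ht => ?_, fun j k hjk => ?_, fun w hw j => ?_⟩
    · fin_cases j
      · obtain rfl | rfl := hzero hs <;> obtain rfl | rfl := hzero ht <;> simp [hxu, hxu.symm]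
      · exact Or.inl ((hone hs).trans (hone ht).symm)
    · fin_cases j <;> fin_cases k
      exacts [absurd rfl hjk, ⟨u, y, hu, hy, huy⟩, ⟨y, u, hy, hu, huy.symm⟩, absurd rfl hjk]
    · fin_cases j
      exacts [⟨x, hx, (hnone hw).1⟩, ⟨y, hy, (hnone hw).2.1⟩]
  refine hτ.not_rigidImpliesSuperStable hv (j₀ := 0) fun w hw => ?_
  obtain rfl | rfl := hzero hw
  · exact ⟨some 1, by decide, fun t ht => hone ht ▸ hxy⟩
  · exact ⟨none, by decide, fun t ht hwt => (hnone ht).2.2 hwt.symm⟩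

theorem IsInducedSquare.not_rigidImpliesSuperStable_of_wheel (h : IsInducedSquare G x u y v)
    {w₀ : V} (hw₀ : w₀ ∉ ({x, u, y, v} : Set V))
    (hout : ∀ w, w ∉ ({x, u, y, v} : Set V) → G.Adj w x ∧ G.Adj w y ∧ G.Adj w v) :
    ¬ RigidImpliesSuperStable G := by
  classical
  obtain ⟨hxu, huy, hyv, hvx, hxy, huv, hxy', huv'⟩ := h
  have hcomm := G.adj_comm
  let τ : V → Option (Fin 3) := fun w =>
    if w = x ∨ w = u then some 0 else if w = y then some 1 else if w = v then some 2 else none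
  have hx : τ x = some 0 := by grind
  have hu : τ u = some 0 := by grind
  have hy : τ y = some 1 := by grind
  have hv : τ v = some 2 := by grind
  have hzero {w : V} (hw : τ w = some 0) : w = x ∨ w = u := by grind
  have hone {w : V} (hw : τ w = some 1) : w = y := by grind
  have htwo {w : V} (hw : τ w = some 2) : w = v := by grind
  have hnone {w : V} (hw : τ w = none) : G.Adj w x ∧ G.Adj w y ∧ G.Adj w v := by grind
  have hτ : IsBarycentricColoring G τ := by
    refine ⟨fun s t j hs ht => ?_, fun j k hjk => ?_, fun w hw j => ?_⟩
    · fin_cases j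
      · obtain rfl | rfl := hzero hs <;> obtain rfl | rfl := hzero ht <;> simp [hxu, hxu.symm]
      · exact Or.inl ((hone hs).trans (hone ht).symm)
      · exact Or.inl ((htwo hs).trans (htwo ht).symm)
    · fin_cases j <;> fin_cases k
      exacts [absurd rfl hjk, ⟨u, y, hu, hy, huy⟩, ⟨x, v, hx, hv, hvx.symm⟩,
        ⟨y, u, hy, hu, huy.symm⟩, absurd rfl hjk, ⟨y, v, hy, hv, hyv⟩,
        ⟨v, x, hv, hx, hvx⟩, ⟨v, y, hv, hy, hyv.symm⟩, absurd rfl hjk]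
    · fin_cases j
      exacts [⟨x, hx, (hnone hw).1⟩, ⟨y, hy, (hnone hw).2.1⟩, ⟨v, hv, (hnone hw).2.2⟩]
  refine hτ.not_rigidImpliesSuperStable (v₀ := w₀) (j₀ := 0) (by grind) fun w hw => ?_
  obtain rfl | rfl := hzero hw
  · exact ⟨some 1, by decide, fun t ht => hone ht ▸ hxy⟩
  · exact ⟨some 2, by decide, fun t ht => htwo ht ▸ huv⟩

theorem RigidImpliesSuperStable.isChordalGraph (hG : RigidImpliesSuperStable G)
    (hconn : G.Connected) : IsChordalGraph G := by
  classical
  induction hn : Fintype.card V using Nat.strong_induction_on generalizing V with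
  | _ n ih =>
    have hcontr : IsContractionChordal G := fun a b hab => by
      have hcard : Fintype.card {v // v ≠ b} < n := hn ▸ Fintype.card_subtype_lt (x := b) (by simp)
      have hsurj := contractionMap_surjective hab
      exact ih _ hcard (hG.map hsurj fun _ _ => eq_or_adj_of_contractionMap_eq hab)
        (connected_map hconn hsurj) rfl
    intro k hk
    obtain rfl | hk := hk.eq_or_lt
    · refine ⟨fun e => ?_⟩
      obtain ⟨x, u, y, v, h, hout⟩ | ⟨w, hw, hout⟩ :=
        hcontr.exists_square hconn (isInducedSquare_of_embedding e)
      · exact h.not_rigidImpliesSuperStable_of_diagonal hout hG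
      · exact (isInducedSquare_of_embedding e).not_rigidImpliesSuperStable_of_wheel hw hout hG
    · exact hcontr.isEmpty_embedding hk

end Converse

theorem theorem8p1 {V : Type*} [Fintype V] (G : SimpleGraph V) :
    (IsChordalGraph G →
      ∀ (d : ℕ) (p : SphericalPlacement V d), IsUniversallyRigid G p → IsSuperStable G p) ∧
    (G.Connected →
      (∀ (d : ℕ) (p : SphericalPlacement V d), IsUniversallyRigid G p → IsSuperStable G p) →
      IsChordalGraph G) :=
  ⟨fun hG _ _ hp => hp.isSuperStable hG,
    fun hconn hG => RigidImpliesSuperStable.isChordalGraph hG hconn⟩
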